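/- Let $G$ be a group and let $\mathbb{Z}G$ be its integral group ring. Denote by $\mathcal{U}_1(\mathbb{Z}G)$ the group of units of $\mathbb{Z}G$ of augmentation one, that is, of units $\sum_{g}\alpha(g)g$ with $\sum_{g}\alpha(g)=1$. A group is called noetherian if its subgroups satisfy the ascending chain condition, locally noetherian if each of its finitely generated subgroups is noetherian, and torsion free if its only element of finite order is the identity. Let $H$ be a normal subgroup of finite index in $G$ that is locally noetherian and torsion free, and let $A$ be a finite subgroup of $\mathcal{U}_1(\mathbb{Z}G)$. Then the order of $A$ divides the index $[G:H]$. Moreover, the restriction to $A$ of the natural projection $\mathbb{Z}G\to\mathbb{Z}(G/H)$ is injective. -/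

import Mathlib

/-- The augmentation `ℤG → ℤ`: the ring homomorphism sending every `g ∈ G` to `1`. -/
noncomputable def augmentation (G : Type*) [Group G] : MonoidAlgebra ℤ G →+* ℤ :=
  (MonoidAlgebra.lift ℤ ℤ G (1 : G →* ℤ)).toRingHom

/-- The augmentation of `∑ α(g) g` is the sum of the coefficients `∑ α(g)`. -/
theorem augmentation_apply {G : Type*} [Group G] (α : MonoidAlgebra ℤ G) :
    augmentation G α = ∑ g ∈ α.coeff.support, α.coeff g := by
  simp [augmentation, MonoidAlgebra.lift_apply', Finsupp.sum]

/-- `U₁(ℤG)`: the group of units of augmentation one of the integral group ring. -/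
noncomputable def unitsAugOne (G : Type*) [Group G] : Subgroup (MonoidAlgebra ℤ G)ˣ :=
  (Units.map (augmentation G).toMonoidHom).ker

theorem mem_unitsAugOne {G : Type*} [Group G] (u : (MonoidAlgebra ℤ G)ˣ) :
    u ∈ unitsAugOne G ↔ augmentation G (u : MonoidAlgebra ℤ G) = 1 := by
  simp [unitsAugOne, MonoidHom.mem_ker, Units.ext_iff]

/-- A group is noetherian if its subgroups satisfy the ascending chain condition. -/
def IsNoetherianGroup (G : Type*) [Group G] : Prop :=
  WellFoundedGT (Subgroup G)

/-- A group is locally noetherian if all its finitely generated subgroups are noetherian. -/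
def IsLocallyNoetherianGroup (G : Type*) [Group G] : Prop :=
  ∀ K : Subgroup G, K.FG → IsNoetherianGroup K

/-- A group is torsion free if the identity is its only element of finite order.
(Mathlib's `IsMulTorsionFree` is stronger for noncommutative groups: it asks for unique roots.) -/
def IsTorsionFreeGroup (G : Type*) [Group G] : Prop :=
  ∀ g : G, IsOfFinOrder g → g = 1

/-! For a torsion element `a` of ℤG, the identity coefficients of `a` and of its image in ℤ(G/H)
differ by the sum of `a` over H∖{1}, a union of conjugacy classes. Class sums are traces, so modulo
p the class sum of `a ^ p ^ k` only sees p^k-th powers of support elements. By the chain condition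
no nontrivial element of H is conjugate to a proper power of itself; hence its class sum is
divisible by infinitely many primes and vanishes, and the two coefficients agree.

On the kernel of A → ℤ(G/H) every identity coefficient is therefore 1. If `e` is the average of the
kernel, the idempotent `1 - e` has identity coefficient 0, so `e = 1` by Kaplansky and the kernel is
trivial.

By Berman–Higman, with augmentation one excluding -1, nontrivial elements of A have images with
identity coefficient 0. The average of the image of A is then an idempotent of trace |G/H|/|A|. This
is a rank, hence an integer. -/

/-! ### Frobenius congruence for traces -/

/-- A weight invariant under a map of `p`-power order and zero on its fixed points has total weight
divisible by `p`. -/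
theorem dvd_sum_of_iterate_prime_pow_eq_id {X : Type*} [Fintype X] {p k : ℕ} (hp : p.Prime)
    (σ : X → X) (hσ : σ^[p ^ k] = id) (w : X → ℤ) (hw : ∀ x, w (σ x) = w x)
    (h0 : ∀ x, σ x = x → w x = 0) : (p : ℤ) ∣ ∑ x, w x := by
  classical
  have : Fact p.Prime := ⟨hp⟩
  rw [← Finset.sum_fiberwise_of_maps_to (t := Finset.univ.image w) (g := w)
    (fun x _ => Finset.mem_image_of_mem w (Finset.mem_univ x))]
  refine Finset.dvd_sum fun v _ => ?_
  rw [Finset.sum_congr rfl (fun x hx => (Finset.mem_filter.mp hx).2), Finset.sum_const, nsmul_eq_mul]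
  by_cases hv : v = 0
  · simp [hv]
  refine Dvd.dvd.mul_right ?_ _
  let f : Function.End {x // w x = v} := fun x => ⟨σ x.1, (hw x.1).trans x.2⟩
  have hf : f ^ p ^ k = 1 := by
    have hit : ∀ (n : ℕ) (x : {x // w x = v}), ((f ^ n) x).1 = σ^[n] x.1 := by
      intro n
      induction n with
      | zero => intro x; rfl
      | succ n ih =>
        intro x
        rw [pow_succ, Function.iterate_succ_apply]
        exact ih (f x)
    funext x
    apply Subtype.ext
    rw [hit, hσ]
    rfl
  have hcard := Equiv.Perm.card_fixedPoints_modEq hf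
  have hempty : IsEmpty (Function.fixedPoints f) :=
    ⟨fun x => hv (x.1.2.symm.trans (h0 _ (congrArg Subtype.val x.2)))⟩
  rw [Fintype.card_eq_zero (α := Function.fixedPoints f), Nat.modEq_zero_iff_dvd,
    Fintype.card_subtype] at hcard
  exact_mod_cast hcard

theorem sum_pow_eq_sum_ofFn_prod {R ι : Type*} [Semiring R] [Fintype ι] (y : ι → R) (n : ℕ) :
    (∑ i, y i) ^ n = ∑ f : Fin n → ι, (List.ofFn fun j => y (f j)).prod := by
  induction n with
  | zero => simp
  | succ n ih =>
    rw [pow_succ', ih, Finset.sum_mul_sum, ← Finset.sum_product', Finset.univ_product_univ]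
    refine Fintype.sum_equiv (Fin.consEquiv fun _ : Fin (n + 1) => ι) _ _ ?_
    rintro ⟨i, f⟩
    simp [List.ofFn_succ, Fin.consEquiv]

open Fin.NatCast Fin.CommRing in
/-- The noncommutative Frobenius congruence for traces. -/
theorem dvd_trace_sum_pow_prime_pow {R ι : Type*} [Ring R] [Fintype ι] (τ : R →+ ℤ)
    (hτ : ∀ x y, τ (x * y) = τ (y * x)) (y : ι → R) {p k : ℕ} (hp : p.Prime)
    (h0 : ∀ i, τ (y i ^ p ^ k) = 0) : (p : ℤ) ∣ τ ((∑ i, y i) ^ p ^ k) := by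
  obtain ⟨n, hn⟩ : ∃ n, p ^ k = n + 1 :=
    ⟨p ^ k - 1, (Nat.succ_pred_eq_of_pos (pow_pos hp.pos k)).symm⟩
  rw [hn] at h0
  rw [sum_pow_eq_sum_ofFn_prod, map_sum, hn]
  -- Rotation of words. Indices wrap modulo `n + 1 = p ^ k`, so `σ^[p ^ k] = id`; its fixed words
  -- are constant.
  let σ : (Fin (n + 1) → ι) → (Fin (n + 1) → ι) := fun f i => f (i + 1)
  have hit : ∀ (m : ℕ) (f : Fin (n + 1) → ι), σ^[m] f = fun i => f (i + (m : Fin (n + 1))) := by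
    intro m
    induction m with
    | zero => intro f; simp
    | succ m ih =>
      intro f
      rw [Function.iterate_succ_apply, ih]
      funext i
      simp [σ, add_assoc]
  refine dvd_sum_of_iterate_prime_pow_eq_id (k := k) hp σ ?_ _ ?_ ?_
  · funext f
    rw [hit, hn]
    simp
  · intro f
    rw [List.ofFn_succ', List.ofFn_succ, List.concat_eq_append, List.prod_append, List.prod_cons,
      hτ]
    simp [σ, Fin.coeSucc_eq_succ]
  · intro f hf
    have hconst : ∀ i, f i = f 0 := by
      intro i
      have h := congrFun (Function.iterate_fixed hf (i : ℕ)) 0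
      rw [hit] at h
      simpa using h
    simp only [hconst, List.ofFn_const, List.prod_replicate]
    exact h0 (f 0)

/-! ### Class sums of torsion elements -/

/-- The sum of the coefficients over a conjugacy class. -/
noncomputable def conjClassSum {G : Type*} [Group G] (C : ConjClasses G) :
    MonoidAlgebra ℤ G →+ ℤ :=
  open Classical in
  (Finsupp.liftAddHom fun g => if ConjClasses.mk g = C then AddMonoidHom.id ℤ else 0).comp
    MonoidAlgebra.coeffAddEquiv.toAddMonoidHom

open Classical in
theorem conjClassSum_single {G : Type*} [Group G] (C : ConjClasses G) (g : G) (c : ℤ) :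
    conjClassSum C (MonoidAlgebra.single g c) = if ConjClasses.mk g = C then c else 0 := by
  simp only [conjClassSum, AddMonoidHom.comp_apply]
  simp
  split_ifs <;> simp

open Classical in
theorem conjClassSum_apply {G : Type*} [Group G] (C : ConjClasses G) (a : MonoidAlgebra ℤ G) :
    conjClassSum C a = ∑ g ∈ a.coeff.support with ConjClasses.mk g = C, a.coeff g := by
  simp only [conjClassSum, AddMonoidHom.comp_apply]
  simp [Finsupp.sum, Finset.sum_filter]
  refine Finset.sum_congr rfl fun g _ => ?_
  split_ifs <;> simp

theorem conjClassSum_mul_comm {G : Type*} [Group G] (C : ConjClasses G) (a b : MonoidAlgebra ℤ G) :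
    conjClassSum C (a * b) = conjClassSum C (b * a) := by
  induction a using MonoidAlgebra.induction_linear with
  | zero => simp
  | add a a' ha ha' => simp [add_mul, mul_add, ha, ha']
  | single g c =>
    induction b using MonoidAlgebra.induction_linear with
    | zero => simp
    | add b b' hb hb' => simp [add_mul, mul_add, hb, hb']
    | single h d =>
      rw [MonoidAlgebra.single_mul_single, MonoidAlgebra.single_mul_single, conjClassSum_single,
        conjClassSum_single, mul_comm c d]
      have : ConjClasses.mk (g * h) = ConjClasses.mk (h * g) :=
        ConjClasses.mk_eq_mk_iff_isConj.mpr (isConj_iff.mpr ⟨h, by group⟩)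
      rw [this]

/-- The class sums of a torsion element vanish on the class of an element that is not conjugate to
any of its proper powers. -/
theorem conjClassSum_eq_zero_of_pow_eq_one {G : Type*} [Group G] {a : MonoidAlgebra ℤ G} {n : ℕ}
    (hn : n ≠ 0) (ha : a ^ n = 1) {x : G} (hx : ∀ m, 2 ≤ m → ¬ IsConj x (x ^ m)) :
    conjClassSum (ConjClasses.mk x) a = 0 := by
  have key : ∀ p : ℕ, p.Prime → p.Coprime n →
      (p : ℤ) ∣ conjClassSum (ConjClasses.mk x) a := by
    intro p hp hpn
    -- Two such exponents for one `g` would make `x` conjugate to a proper power of itself.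
    have hsub : ∀ g : G, {k : ℕ | IsConj (g ^ p ^ k) x}.Subsingleton := by
      have hlt : ∀ (g : G) (k l : ℕ), k < l → IsConj (g ^ p ^ k) x → ¬ IsConj (g ^ p ^ l) x := by
        intro g k l hkl hk hl
        refine hx (p ^ (l - k)) ?_ ?_
        · exact hp.two_le.trans (Nat.le_self_pow (by omega) p)
        · refine hl.symm.trans ?_
          have h : g ^ p ^ l = (g ^ p ^ k) ^ p ^ (l - k) := by
            rw [← pow_mul, ← pow_add]
            congr 2
            omega
          rw [h]
          exact hk.pow _
      intro g k hk l hl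
      rcases lt_trichotomy k l with h | h | h
      · exact absurd hl (hlt g k l h hk)
      · exact h
      · exact absurd hk (hlt g l k h hl)
    have hfin : (⋃ g ∈ a.coeff.support, {k : ℕ | IsConj (g ^ p ^ k) x}).Finite :=
      a.coeff.support.finite_toSet.biUnion fun g _ => (hsub g).finite
    have hφ : 0 < n.totient := Nat.totient_pos.mpr (Nat.pos_of_ne_zero hn)
    -- Multiples of φ(n) give `p ^ k ≡ 1` mod `n`, hence `a ^ p ^ k = a`; being infinitely many, one
    -- avoids the finite bad set.
    obtain ⟨k, ⟨j, hj⟩, hk⟩ := (Set.infinite_range_of_injective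
      (f := fun j : ℕ => n.totient * j) (fun i j h => Nat.eq_of_mul_eq_mul_left hφ h)).exists_notMem_finite hfin
    have hmod : p ^ k ≡ 1 [MOD n] := by
      rw [← hj, pow_mul]
      simpa using (Nat.ModEq.pow_totient hpn).pow j
    have hpow : a ^ p ^ k = a := by
      obtain ⟨c, hc⟩ := (Nat.modEq_iff_dvd' (Nat.one_le_pow _ _ hp.pos)).mp hmod.symm
      have hq : p ^ k = n * c + 1 := by
        have := Nat.one_le_pow k p hp.pos
        omega
      rw [hq, pow_succ, pow_mul, ha, one_pow, one_mul]
    have hsum : ∑ g : a.coeff.support, MonoidAlgebra.single (g : G) (a.coeff g) = a := by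
      rw [Finset.sum_coe_sort a.coeff.support fun g => MonoidAlgebra.single g (a.coeff g)]
      exact MonoidAlgebra.sum_coeff_single a
    rw [← hpow, ← hsum]
    refine dvd_trace_sum_pow_prime_pow _ (conjClassSum_mul_comm _) _ hp fun g => ?_
    rw [MonoidAlgebra.single_pow, conjClassSum_single, if_neg]
    intro h
    exact hk (Set.mem_biUnion g.2 (ConjClasses.mk_eq_mk_iff_isConj.mp h))
  by_contra hne
  obtain ⟨p, hpgt, hp⟩ := Nat.exists_infinite_primes
    (max n (conjClassSum (ConjClasses.mk x) a).natAbs + 1)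
  have hpn : p.Coprime n :=
    (hp.coprime_iff_not_dvd).mpr fun h => by
      have := Nat.le_of_dvd (Nat.pos_of_ne_zero hn) h
      omega
  have := Nat.le_of_dvd (Int.natAbs_pos.mpr hne) (Int.natCast_dvd.mp (key p hp hpn))
  omega

/-! ### Conjugacy to proper powers -/

/-- In a locally noetherian torsion-free group, `s * x * s⁻¹ = x ^ M` with `2 ≤ M` forces `x = 1`. -/
theorem eq_one_of_conj_eq_pow {H : Type*} [Group H] (hnoeth : IsLocallyNoetherianGroup H)
    (htf : IsTorsionFreeGroup H) {x s : H} {M : ℕ} (hM : 2 ≤ M) (h : s * x * s⁻¹ = x ^ M) :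
    x = 1 := by
  let K : Subgroup H := Subgroup.closure {x, s}
  have hK : WellFoundedGT (Subgroup K) :=
    hnoeth K ((Subgroup.fg_iff K).mpr ⟨{x, s}, rfl, by simp⟩)
  let X : K := ⟨x, Subgroup.subset_closure (by simp)⟩
  let S : K := ⟨s, Subgroup.subset_closure (by simp)⟩
  have hXS : S * X * S⁻¹ = X ^ M := Subtype.ext h
  -- Successive `M`-th roots of `X` generate an ascending chain of cyclic groups. Once it
  -- stabilises, a root `Y` satisfies `Y = Y ^ (M * z)`, so it is torsion.
  have hstep : ∀ i : ℕ, S⁻¹ ^ i * X * S ^ i = (S⁻¹ ^ (i + 1) * X * S ^ (i + 1)) ^ M := by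
    intro i
    have h1 : S⁻¹ ^ (i + 1) * X * S ^ (i + 1) = S⁻¹ ^ (i + 1) * X * (S⁻¹ ^ (i + 1))⁻¹ := by simp
    rw [h1, conj_pow, ← hXS, inv_pow, inv_pow, inv_inv, pow_succ']
    group
  have hmono : Monotone fun i : ℕ => Subgroup.zpowers (S⁻¹ ^ i * X * S ^ i) := by
    refine monotone_nat_of_le_succ fun i => ?_
    rw [Subgroup.zpowers_le, hstep i]
    exact pow_mem (Subgroup.mem_zpowers (S⁻¹ ^ (i + 1) * X * S ^ (i + 1))) _
  obtain ⟨i, hi⟩ := WellFoundedGT.monotone_chain_condition ⟨_, hmono⟩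
  have hmem : S⁻¹ ^ (i + 1) * X * S ^ (i + 1) ∈ Subgroup.zpowers (S⁻¹ ^ i * X * S ^ i) := by
    have := hi (i + 1) (Nat.le_succ i)
    simp only [OrderHom.coe_mk] at this
    rw [this]
    exact Subgroup.mem_zpowers _
  obtain ⟨z, hz⟩ := Subgroup.mem_zpowers_iff.mp hmem
  set Y := S⁻¹ ^ (i + 1) * X * S ^ (i + 1) with hY
  have hYz : Y ^ ((M : ℤ) * z - 1) = 1 := by
    rw [zpow_sub_one, zpow_mul, zpow_natCast, ← hstep, hz, mul_inv_cancel]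
  have hne : (M : ℤ) * z - 1 ≠ 0 := by
    intro h0
    have hd : (M : ℤ) ∣ 1 := ⟨z, by omega⟩
    have := Int.le_of_dvd one_pos hd
    omega
  have hYfin : IsOfFinOrder (Y : H) := by
    refine isOfFinOrder_iff_zpow_eq_one.mpr ⟨_, hne, ?_⟩
    exact_mod_cast congrArg Subtype.val hYz
  have hY1 : Y = 1 := Subtype.ext (htf _ hYfin)
  have hX1 : X = 1 := by
    have : X = S ^ (i + 1) * Y * (S ^ (i + 1))⁻¹ := by rw [hY, inv_pow]; group
    rw [this, hY1]; simp
  exact congrArg Subtype.val hX1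

/-- If `t` conjugates `x` to `x ^ m`, then `t ^ H.index` lies in `H` and conjugates `x` to `x ^ m ^
H.index`, which reduces the claim to `H`. -/
theorem not_isConj_pow {G : Type*} [Group G] (H : Subgroup G) [H.Normal] [H.FiniteIndex]
    (hnoeth : IsLocallyNoetherianGroup H) (htf : IsTorsionFreeGroup H) {x : G} (hxH : x ∈ H)
    (hx : x ≠ 1) {m : ℕ} (hm : 2 ≤ m) : ¬ IsConj x (x ^ m) := by
  intro hc
  obtain ⟨t, ht⟩ := isConj_iff.mp hc
  have hpow : ∀ n : ℕ, t ^ n * x * (t ^ n)⁻¹ = x ^ m ^ n := by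
    intro n
    induction n with
    | zero => simp
    | succ n ih =>
      calc t ^ (n + 1) * x * (t ^ (n + 1))⁻¹ = t * (t ^ n * x * (t ^ n)⁻¹) * t⁻¹ := by
            rw [pow_succ']; group
        _ = (t * x * t⁻¹) ^ m ^ n := by rw [ih, conj_pow]
        _ = x ^ m ^ (n + 1) := by rw [ht, ← pow_mul, pow_succ']
  have hx1 : (⟨x, hxH⟩ : H) = 1 :=
    eq_one_of_conj_eq_pow hnoeth htf (s := ⟨t ^ H.index, H.pow_index_mem t⟩) (M := m ^ H.index)
      (hm.trans (Nat.le_self_pow Subgroup.FiniteIndex.index_ne_zero m))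
      (Subtype.ext (hpow H.index))
  exact hx (congrArg Subtype.val hx1)

/-- The identity coefficient of a torsion element of `ℤG` is unchanged by passing to `ℤ(G/H)`. -/
theorem coeff_one_mapDomain_mk_of_pow_eq_one {G : Type*} [Group G] (H : Subgroup G) [H.Normal]
    [H.FiniteIndex] (hnoeth : IsLocallyNoetherianGroup H) (htf : IsTorsionFreeGroup H)
    {a : MonoidAlgebra ℤ G} {n : ℕ} (hn : n ≠ 0) (ha : a ^ n = 1) :
    (MonoidAlgebra.mapDomainRingHom ℤ (QuotientGroup.mk' H) a).coeff 1 = a.coeff 1 := by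
  classical
  have h1 : (MonoidAlgebra.mapDomainRingHom ℤ (QuotientGroup.mk' H) a).coeff 1 =
      ∑ g ∈ a.coeff.support with g ∈ H, a.coeff g := by
    simp [MonoidAlgebra.mapDomain, Finsupp.mapDomain, Finsupp.sum, Finset.sum_filter,
      Finsupp.single_apply, Finsupp.finsetSum_apply]
  have h2 : ∑ g ∈ a.coeff.support with g ∈ H ∧ g ≠ 1, a.coeff g = 0 := by
    rw [← Finset.sum_fiberwise_of_maps_to
      (t := (a.coeff.support.filter fun g => g ∈ H ∧ g ≠ 1).image ConjClasses.mk)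
      (g := ConjClasses.mk) (fun x hx => Finset.mem_image_of_mem _ hx)]
    refine Finset.sum_eq_zero fun C hC => ?_
    obtain ⟨x, hx, rfl⟩ := Finset.mem_image.mp hC
    obtain ⟨-, hxH, hx1⟩ := Finset.mem_filter.mp hx
    rw [← conjClassSum_eq_zero_of_pow_eq_one hn ha
      (fun m hm => not_isConj_pow H hnoeth htf hxH hx1 hm), conjClassSum_apply, Finset.filter_filter]
    refine Finset.sum_congr (Finset.filter_congr fun g _ => ?_) fun _ _ => rfl
    refine and_iff_right_of_imp fun h => ?_
    obtain ⟨t, ht⟩ := isConj_iff.mp (ConjClasses.mk_eq_mk_iff_isConj.mp h.symm)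
    rw [← ht]
    exact ⟨Subgroup.Normal.conj_mem ‹_› x hxH t, fun h1 => hx1 (conj_eq_one_iff.mp h1)⟩
  rw [h1, ← Finset.sum_filter_add_sum_filter_not _ (fun g => g ≠ 1), Finset.filter_filter, h2,
    Finset.filter_filter, zero_add]
  rw [Finset.sum_filter, Finset.sum_congr rfl (g := fun g => if g = 1 then a.coeff 1 else 0)]
  · rw [Finset.sum_ite_eq']
    split_ifs with h
    · rfl
    · exact (Finsupp.notMem_support_iff.mp h).symm
  · intro g _
    by_cases hg : g = 1 <;> simp [hg, H.one_mem]

/-! ### Kaplansky's theorem on idempotents -/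

namespace MonoidAlgebra

variable {G : Type*}

/-- The standard inner product on a real group algebra. -/
noncomputable def dot (x y : MonoidAlgebra ℝ G) : ℝ := ∑ᶠ g, x.coeff g * y.coeff g

theorem dot_comm (x y : MonoidAlgebra ℝ G) : dot x y = dot y x :=
  finsum_congr fun _ => mul_comm _ _

theorem finite_support_coeff_mul_coeff (x y : MonoidAlgebra ℝ G) :
    (Function.support fun g => x.coeff g * y.coeff g).Finite :=
  x.coeff.hasFiniteSupport.subset fun _ hg => left_ne_zero_of_mul hg

theorem dot_add_left (x y z : MonoidAlgebra ℝ G) : dot (x + y) z = dot x z + dot y z := by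
  rw [dot, dot, dot, ← finsum_add_distrib (finite_support_coeff_mul_coeff _ _)
    (finite_support_coeff_mul_coeff _ _)]
  exact finsum_congr fun g => by simp [add_mul]

theorem dot_smul_left (t : ℝ) (x y : MonoidAlgebra ℝ G) : dot (t • x) y = t * dot x y := by
  rw [dot, dot, ← smul_eq_mul, smul_finsum]
  exact finsum_congr fun g => by simp [mul_assoc]

theorem dot_sub_left (x y z : MonoidAlgebra ℝ G) : dot (x - y) z = dot x z - dot y z := by
  rw [sub_eq_add_neg, ← neg_one_smul ℝ y, dot_add_left, dot_smul_left]
  ring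

theorem dot_sub_right (x y z : MonoidAlgebra ℝ G) : dot x (y - z) = dot x y - dot x z := by
  rw [dot_comm, dot_sub_left, dot_comm y, dot_comm z]

theorem dot_smul_right (t : ℝ) (x y : MonoidAlgebra ℝ G) : dot x (t • y) = t * dot x y := by
  rw [dot_comm, dot_smul_left, dot_comm]

theorem dot_self_nonneg (x : MonoidAlgebra ℝ G) : 0 ≤ dot x x :=
  finsum_nonneg fun _ => mul_self_nonneg _

theorem dot_sub_smul_self (x y : MonoidAlgebra ℝ G) (t : ℝ) :
    dot (x - t • y) (x - t • y) = dot y y * (t * t) + -2 * dot x y * t + dot x x := by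
  simp only [dot_sub_left, dot_sub_right, dot_smul_left, dot_smul_right, dot_comm y x]
  ring

theorem dot_sq_le (x y : MonoidAlgebra ℝ G) : dot x y ^ 2 ≤ dot x x * dot y y := by
  have h := discrim_le_zero (a := dot y y) (b := -2 * dot x y) (c := dot x x) fun t => by
    rw [← dot_sub_smul_self]
    exact dot_self_nonneg _
  rw [discrim] at h
  nlinarith

theorem dot_eq_sum_right (x y : MonoidAlgebra ℝ G) :
    dot x y = ∑ g ∈ y.coeff.support, x.coeff g * y.coeff g :=
  finsum_eq_sum_of_support_subset _ fun _ hg =>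
    Finsupp.mem_support_iff.mpr (right_ne_zero_of_mul hg)

variable [Group G]

theorem dot_one_left (x : MonoidAlgebra ℝ G) : dot 1 x = x.coeff 1 := by
  rw [dot, finsum_eq_single _ (1 : G)]
  · simp
  · intro g hg
    simp [one_def, hg.symm]

theorem dot_mul_single_mul_single (x y : MonoidAlgebra ℝ G) (g : G) :
    dot (x * single g 1) (y * single g 1) = dot x y := by
  rw [dot, dot]
  simp only [coeff_mul_single_apply, mul_one]
  exact finsum_comp_equiv (Equiv.mulRight g⁻¹) (f := fun h => x.coeff h * y.coeff h)

theorem dot_mul_single_left (x y : MonoidAlgebra ℝ G) (g : G) :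
    dot (x * single g 1) y = dot x (y * single g⁻¹ 1) := by
  rw [← dot_mul_single_mul_single _ _ g⁻¹, mul_assoc, single_mul_single]
  simp [← one_def]

/-- Almost minimisers of the distance to `1` in the right ideal `{β | e * β = β}`. -/
theorem exists_almost_orthogonal_projection (e : MonoidAlgebra ℝ G) {ε : ℝ} (hε : 0 < ε) :
    ∃ α : MonoidAlgebra ℝ G, e * α = α ∧ dot α α ≤ 4 + 2 * ε ^ 2 ∧
      ∀ β, e * β = β → dot (1 - α) β ^ 2 ≤ ε ^ 2 * dot β β := by
  let S : Set ℝ := {r | ∃ α : MonoidAlgebra ℝ G, e * α = α ∧ r = dot (1 - α) (1 - α)}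
  have hbdd : BddBelow S := ⟨0, by rintro _ ⟨α, -, rfl⟩; exact dot_self_nonneg _⟩
  have h1 : (1 : ℝ) ∈ S := ⟨0, by simp, by simp [dot_one_left]⟩
  have hd1 : sInf S ≤ 1 := csInf_le hbdd h1
  obtain ⟨r, ⟨α, hα, rfl⟩, hr⟩ :=
    exists_lt_of_csInf_lt ⟨1, h1⟩ (lt_add_of_pos_right (sInf S) (pow_pos hε 2))
  refine ⟨α, hα, ?_, fun β hβ => ?_⟩
  -- Parallelogram law for `1` and `1 - α`: ‖α‖² ≤ 2‖1‖² + 2‖1 - α‖², with ‖1 - α‖² < 1 + ε².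
  · have h2 := dot_self_nonneg (1 - (-1 : ℝ) • (1 - α))
    have h3 := dot_sub_smul_self 1 (1 - α) 1
    have h4 := dot_sub_smul_self 1 (1 - α) (-1)
    rw [one_smul, sub_sub_cancel] at h3
    have h5 : dot (1 : MonoidAlgebra ℝ G) 1 = 1 := by simp [dot_one_left]
    linarith
  -- Near-minimality keeps ‖1 - α - tβ‖² above ‖1 - α‖² - ε² for all `t`.
  · have h := discrim_le_zero (a := dot β β) (b := -2 * dot (1 - α) β) (c := ε ^ 2) fun t => by
      have hmem : dot (1 - α - t • β) (1 - α - t • β) ∈ S :=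
        ⟨α + t • β, by rw [mul_add, mul_smul_comm, hα, hβ], by rw [sub_sub]⟩
      have := csInf_le hbdd hmem
      rw [dot_sub_smul_self] at this
      linarith
    rw [discrim] at h
    nlinarith

/-- Kaplansky: an idempotent of a real group algebra with vanishing identity coefficient is `0`. -/
theorem eq_zero_of_isIdempotentElem_of_coeff_one_eq_zero {e : MonoidAlgebra ℝ G}
    (he : IsIdempotentElem e) (h0 : e.coeff 1 = 0) : e = 0 := by
  let E := dot e e
  let l := ∑ h ∈ e.coeff.support, |e.coeff h|
  let C := E + 6 * l + 4
  have hE : 0 ≤ E := dot_self_nonneg e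
  have hl : 0 ≤ l := Finset.sum_nonneg fun _ _ => abs_nonneg _
  have hC : 0 ≤ C := by positivity
  -- Up to O(ε), α is the projection of `1` to the ideal and is self-adjoint. Since `e * α = α`,
  -- ‖α‖² ≈ α(1) ≈ ⟨α, e⟩ ≈ e(1) = 0, so e(g) = ⟨1, e g⁻¹⟩ ≈ ⟨α, e g⁻¹⟩ ≈ 0.
  have key : ∀ (g : G) (ε : ℝ), 0 < ε → ε ≤ 1 → e.coeff g ^ 2 ≤ 2 * (1 + C) * E * ε := by
    intro g ε hε hε1
    obtain ⟨α, hα, hαα, horth⟩ := exists_almost_orthogonal_projection e hε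
    have hε2 : ε ^ 2 ≤ ε := by nlinarith
    have hαshift : ∀ h, |dot (1 - α) (α * single h 1)| ≤ 3 * ε := by
      intro h
      refine abs_le_of_sq_le_sq ((horth _ (by rw [← mul_assoc, hα])).trans ?_) (by positivity)
      rw [dot_mul_single_mul_single]
      nlinarith [sq_nonneg ε]
    -- Both coefficients are within 3ε of ⟨α, αh⟩ = ⟨αh⁻¹, α⟩.
    have hsymm : ∀ h, |α.coeff h⁻¹ - α.coeff h| ≤ 6 * ε := by
      intro h
      have hA := hαshift h
      have hB := hαshift h⁻¹
      rw [dot_sub_left, dot_one_left, coeff_mul_single_apply, mul_one, one_mul] at hA hB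
      rw [← dot_mul_single_left, dot_comm, inv_inv] at hB
      rw [abs_le] at hA hB ⊢
      constructor <;> linarith
    have htr : α.coeff 1 = ∑ h ∈ e.coeff.support, e.coeff h * α.coeff h⁻¹ := by
      conv_lhs => rw [← hα]
      rw [coeff_mul_apply_left]
      simp [Finsupp.sum]
    have hself : dot α α ≤ α.coeff 1 + 3 * ε := by
      have h := hαshift 1
      rw [← one_def, mul_one, dot_sub_left, dot_one_left, abs_le] at h
      linarith
    have hαe : dot α e ≤ ε * (E + 1) := by
      have h : |dot (1 - α) e| ≤ ε * (E + 1) := by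
        refine abs_le_of_sq_le_sq ((horth e he).trans ?_) (by positivity)
        rw [mul_pow]
        exact mul_le_mul_of_nonneg_left (by change E ≤ _; nlinarith) (sq_nonneg ε)
      rw [dot_sub_left, dot_one_left, h0, abs_le] at h
      linarith
    have hcomp : α.coeff 1 ≤ dot α e + 6 * ε * l := by
      rw [htr, dot_eq_sum_right, Finset.mul_sum, ← Finset.sum_add_distrib]
      refine Finset.sum_le_sum fun h _ => ?_
      have h1 : e.coeff h * (α.coeff h⁻¹ - α.coeff h) ≤ |e.coeff h| * (6 * ε) := by
        refine (le_abs_self _).trans ?_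
        rw [abs_mul]
        exact mul_le_mul_of_nonneg_left (hsymm h) (abs_nonneg _)
      linarith
    have hααC : dot α α ≤ C * ε := by
      have : C * ε = ε * (E + 1) + 6 * ε * l + 3 * ε := by ring
      linarith
    have hg : e.coeff g = dot (1 - α) (e * single g⁻¹ 1) + dot α (e * single g⁻¹ 1) := by
      rw [dot_sub_left, dot_one_left, coeff_mul_single_apply]
      simp
    have hX := horth (e * single g⁻¹ 1) (by rw [← mul_assoc, he.eq])
    have hY := dot_sq_le α (e * single g⁻¹ 1)
    rw [dot_mul_single_mul_single] at hX hY
    change _ ≤ ε ^ 2 * E at hX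
    change _ ≤ dot α α * E at hY
    rw [hg]
    have h1 := mul_le_mul_of_nonneg_right hααC hE
    have h2 := mul_le_mul_of_nonneg_right hε2 hE
    refine add_sq_le.trans ?_
    linarith
  ext g
  by_contra hne
  have hne' : e.coeff g ≠ 0 := hne
  have hc : 0 < e.coeff g ^ 2 := by positivity
  set c := e.coeff g ^ 2
  have hK : 0 ≤ 2 * (1 + C) * E := by positivity
  set K := 2 * (1 + C) * E
  -- This ε makes `K * ε` smaller than `c`.
  have h := key g (c / (c + K)) (by positivity) ((div_le_one (by positivity)).mpr (by linarith))
  rw [← mul_div_assoc, le_div_iff₀ (by positivity)] at h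
  nlinarith

end MonoidAlgebra

/-! ### The Berman–Higman theorem -/

open Polynomial in
/-- A complex operator of finite order whose normalised trace is an integer has trace `0` or is
`1` or `-1`. -/
theorem Module.End.eq_one_or_neg_one_of_trace_eq {V : Type*} [AddCommGroup V] [Module ℂ V]
    [FiniteDimensional ℂ V] {f : Module.End ℂ V} {m : ℕ} (hm : m ≠ 0) (hf : f ^ m = 1) {k : ℤ}
    (hk : LinearMap.trace ℂ V f = Module.finrank ℂ V * k) : k = 0 ∨ f = 1 ∨ f = -1 := by
  by_cases hk0 : k = 0
  · exact Or.inl hk0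
  right
  have hsplit : f.charpoly.Splits := IsAlgClosed.splits _
  have hcard : f.charpoly.roots.card = Module.finrank ℂ V := by
    rw [← hsplit.natDegree_eq_card_roots, LinearMap.charpoly_natDegree]
  have hroot : ∀ μ ∈ f.charpoly.roots, ‖μ‖ = 1 := by
    intro μ hμ
    have hev : f.HasEigenvalue μ :=
      (Module.End.hasEigenvalue_iff_isRoot_charpoly f μ).mpr (isRoot_of_mem_roots hμ)
    obtain ⟨v, hv⟩ := hev.exists_hasEigenvector
    have h1 := hv.pow_apply m
    rw [hf, Module.End.one_apply] at h1
    have h2 : μ ^ m = 1 := by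
      have h3 : (μ ^ m - 1) • v = 0 := by rw [sub_smul, one_smul, ← h1, sub_self]
      exact sub_eq_zero.mp ((smul_eq_zero.mp h3).resolve_right hv.2)
    exact Complex.norm_eq_one_of_pow_eq_one h2 hm
  rw [Module.End.trace_eq_sum_roots_charpoly_of_splits hsplit] at hk
  -- The roots have modulus 1 and mean `k ≠ 0`, so |k| = 1; equality in the triangle inequality
  -- makes them all equal to `k`.
  obtain ⟨s, hs, hall⟩ : ∃ s : ℂ, (s = 1 ∨ s = -1) ∧ ∀ μ ∈ f.charpoly.roots, μ = s := by
    have hle : ‖f.charpoly.roots.sum‖ ≤ Module.finrank ℂ V := by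
      rw [← hcard]
      refine (norm_multiset_sum_le _).trans ?_
      rw [Multiset.map_congr rfl hroot]
      simp
    rcases Nat.eq_zero_or_pos (Module.finrank ℂ V) with hn | hn
    · refine ⟨1, Or.inl rfl, fun μ hμ => ?_⟩
      rw [hn, Multiset.card_eq_zero] at hcard
      simp [hcard] at hμ
    have hk1 : |k| = 1 := by
      rw [hk, norm_mul, Complex.norm_natCast, Complex.norm_intCast] at hle
      have hn' : (0 : ℝ) < Module.finrank ℂ V := by exact_mod_cast hn
      have h1 : ((|k| : ℤ) : ℝ) ≤ 1 := by
        push_cast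
        by_contra hgt
        nlinarith
      have h2 : |k| ≤ 1 := by exact_mod_cast h1
      have h3 : 0 < |k| := abs_pos.mpr hk0
      omega
    have hkk : (k : ℂ) * k = 1 := by
      have : k * k = 1 := by rw [← abs_mul_abs_self, hk1]; rfl
      exact_mod_cast this
    have hks : (k : ℂ) = 1 ∨ (k : ℂ) = -1 := mul_self_eq_one_iff.mp hkk
    refine ⟨k, hks, ?_⟩
    have hre : ∀ μ ∈ f.charpoly.roots, ((k : ℂ) * μ).re ≤ 1 := by
      intro μ hμ
      refine (Complex.re_le_norm _).trans ?_
      rw [norm_mul, hroot μ hμ, Complex.norm_intCast, ← Int.cast_abs, hk1]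
      simp
    have hsum : (f.charpoly.roots.map fun μ => 1 - ((k : ℂ) * μ).re).sum = 0 := by
      rw [Multiset.sum_map_sub, Multiset.map_const', Multiset.sum_replicate, hcard]
      have h1 : (f.charpoly.roots.map fun μ => ((k : ℂ) * μ).re).sum =
          ((k : ℂ) * f.charpoly.roots.sum).re := by
        induction f.charpoly.roots using Multiset.induction with
        | empty => simp
        | cons μ s ih => simp only [Multiset.map_cons, Multiset.sum_cons, mul_add, Complex.add_re, ih]
      rw [h1, hk, mul_left_comm, hkk]
      simp
    intro μ hμ
    have hzero : 1 - ((k : ℂ) * μ).re = 0 := by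
      refine Multiset.all_zero_of_le_zero_le_of_sum_eq_zero ?_ hsum _
        (Multiset.mem_map_of_mem _ hμ)
      intro x hx
      obtain ⟨ν, hν, rfl⟩ := Multiset.mem_map.mp hx
      linarith [hre ν hν]
    have hnorm : ‖(k : ℂ) * μ‖ = 1 := by
      rw [norm_mul, hroot μ hμ, Complex.norm_intCast, ← Int.cast_abs, hk1]
      simp
    have h1 : (k : ℂ) * μ = 1 := by
      have h2 : ((k : ℂ) * μ).re = 1 := by linarith
      have h3 : ((k : ℂ) * μ).im = 0 := by
        have h4 := Complex.sq_norm ((k : ℂ) * μ)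
        rw [hnorm, Complex.normSq_apply, h2] at h4
        nlinarith
      exact Complex.ext (by simpa using h2) (by simpa using h3)
    calc μ = ((k : ℂ) * k) * μ := by rw [hkk, one_mul]
      _ = k := by rw [mul_assoc, h1, mul_one]
  have hchar : f.charpoly = (X - C s) ^ Module.finrank ℂ V := by
    rw [hsplit.eq_prod_roots_of_monic (LinearMap.charpoly_monic f),
      Multiset.map_congr rfl (g := fun _ => X - C s) (fun μ hμ => by rw [hall μ hμ]),
      Multiset.map_const', Multiset.prod_replicate, hcard]
  have hsq : Squarefree (minpoly ℂ f) := by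
    have hdvd : minpoly ℂ f ∣ X ^ m - 1 := minpoly.dvd _ _ (by simp [hf])
    exact (X_pow_sub_one_separable_iff.mpr (Nat.cast_ne_zero.mpr hm)).squarefree.squarefree_of_dvd
      hdvd
  have hdvd : minpoly ℂ f ∣ X - C s := by
    -- The extra factor keeps the exponent nonzero when `V = 0`.
    have h1 : minpoly ℂ f ∣ (X - C s) ^ (Module.finrank ℂ V + 1) := by
      rw [pow_succ, ← hchar]
      exact (LinearMap.minpoly_dvd_charpoly f).mul_right _
    exact (hsq.dvd_pow_iff_dvd (Nat.succ_ne_zero _)).mp h1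
  have hfs : f = algebraMap ℂ _ s := by
    have := (minpoly.dvd_iff).mp hdvd
    simpa [sub_eq_zero] using this
  rcases hs with rfl | rfl
  · left; simpa using hfs
  · right; simpa using hfs

theorem MonoidAlgebra.trace_mulLeft {K Q : Type*} [Field K] [Group Q] [Finite Q]
    (x : MonoidAlgebra K Q) :
    LinearMap.trace K (MonoidAlgebra K Q) (LinearMap.mulLeft K x) = Nat.card Q * x.coeff 1 := by
  classical
  have := Fintype.ofFinite Q
  rw [LinearMap.trace_eq_matrix_trace K (MonoidAlgebra.basis Q K), Matrix.trace]
  have h : ∀ g, Matrix.diag (LinearMap.toMatrix (MonoidAlgebra.basis Q K) (MonoidAlgebra.basis Q K)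
      (LinearMap.mulLeft K x)) g = x.coeff 1 := by
    intro g
    rw [Matrix.diag_apply, LinearMap.toMatrix_apply, MonoidAlgebra.basis_apply]
    change (x * MonoidAlgebra.single g 1).coeff g = _
    simp
  rw [Finset.sum_congr rfl fun g _ => h g]
  simp

theorem MonoidAlgebra.finrank_eq_card {K Q : Type*} [Field K] :
    Module.finrank K (MonoidAlgebra K Q) = Nat.card Q :=
  Module.finrank_eq_nat_card_basis (MonoidAlgebra.basis Q K)

/-- Berman and Higman: a torsion unit of the integral group ring of a finite group has vanishing
identity coefficient, unless it is `1` or `-1`. -/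
theorem MonoidAlgebra.coeff_one_eq_zero_of_pow_eq_one {Q : Type*} [Group Q] [Finite Q]
    {u : MonoidAlgebra ℤ Q} {n : ℕ} (hn : n ≠ 0) (hu : u ^ n = 1) :
    u.coeff 1 = 0 ∨ u = 1 ∨ u = -1 := by
  let ι := MonoidAlgebra.mapRingHom Q (Int.castRingHom ℂ)
  have hι : Function.Injective ι := MonoidAlgebra.map_injective _ Int.cast_injective
  have : FiniteDimensional ℂ (MonoidAlgebra ℂ Q) := Module.Finite.of_basis (MonoidAlgebra.basis Q ℂ)
  have hpow : LinearMap.mulLeft ℂ (ι u) ^ n = 1 := by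
    rw [LinearMap.pow_mulLeft, ← map_pow, hu, map_one, LinearMap.mulLeft_one]
    rfl
  have htr : LinearMap.trace ℂ (MonoidAlgebra ℂ Q) (LinearMap.mulLeft ℂ (ι u)) =
      Module.finrank ℂ (MonoidAlgebra ℂ Q) * (u.coeff 1 : ℤ) := by
    rw [MonoidAlgebra.trace_mulLeft, MonoidAlgebra.finrank_eq_card]
    simp [ι]
  refine (Module.End.eq_one_or_neg_one_of_trace_eq hn hpow htr).imp_right (Or.imp ?_ ?_)
  · intro h
    have h1 := LinearMap.congr_fun h 1
    exact hι (by simpa using h1)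
  · intro h
    have h1 := LinearMap.congr_fun h 1
    exact hι (by simpa using h1)

/-! ### Averages over finite groups -/

/-- The average of the image of a finite group in an algebra. -/
noncomputable def groupAverage (K : Type*) {R B : Type*} [Field K] [Ring R] [Algebra K R] [Group B]
    [Fintype B] (φ : B →* R) : R :=
  (Fintype.card B : K)⁻¹ • ∑ b, φ b

section

variable {K R B : Type*} [Field K] [Ring R] [Algebra K R] [Group B] [Fintype B]
  (φ : B →* R)

theorem map_mul_groupAverage (b : B) : φ b * groupAverage K φ = groupAverage K φ := by
  rw [groupAverage, mul_smul_comm, Finset.mul_sum]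
  congr 1
  exact Fintype.sum_equiv (Equiv.mulLeft b) _ _ fun c => by simp

theorem isIdempotentElem_groupAverage [CharZero K] : IsIdempotentElem (groupAverage K φ) := by
  have hcard : (Fintype.card B : K) ≠ 0 := Nat.cast_ne_zero.mpr Fintype.card_ne_zero
  rw [IsIdempotentElem]
  conv_lhs => enter [1]; rw [groupAverage]
  rw [smul_mul_assoc, Finset.sum_mul, Finset.sum_congr rfl fun b _ => map_mul_groupAverage φ b,
    Finset.sum_const, Finset.card_univ, ← Nat.cast_smul_eq_nsmul K, smul_smul,
    inv_mul_cancel₀ hcard, one_smul]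

end

theorem MonoidAlgebra.coeff_groupAverage {K B Q : Type*} [Field K] [Group B] [Fintype B] [Group Q]
    (φ : B →* MonoidAlgebra K Q) (g : Q) :
    (groupAverage K φ).coeff g = (Fintype.card B : K)⁻¹ * ∑ b, (φ b).coeff g := by
  simp [groupAverage]

/-- A finite group of units of `ℤG` all of whose elements have identity coefficient `1` is
trivial. -/
theorem MonoidAlgebra.eq_one_of_forall_coeff_one_eq_one {G B : Type*} [Group G] [Group B] [Finite B]
    (φ : B →* MonoidAlgebra ℤ G) (hφ : ∀ b, (φ b).coeff 1 = 1) (b : B) : φ b = 1 := by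
  have := Fintype.ofFinite B
  let ι := MonoidAlgebra.mapRingHom G (Int.castRingHom ℝ)
  have hι : Function.Injective ι := MonoidAlgebra.map_injective _ Int.cast_injective
  let e := groupAverage ℝ (ι.toMonoidHom.comp φ)
  have hcoeff : e.coeff 1 = 1 := by
    rw [MonoidAlgebra.coeff_groupAverage]
    have hcard : (Fintype.card B : ℝ) ≠ 0 := Nat.cast_ne_zero.mpr Fintype.card_ne_zero
    simp [ι, hφ, hcard]
  have he : 1 - e = 0 := by
    refine eq_zero_of_isIdempotentElem_of_coeff_one_eq_zero
      (isIdempotentElem_groupAverage _).one_sub ?_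
    simp [hcoeff]
  have h := map_mul_groupAverage (K := ℝ) (ι.toMonoidHom.comp φ) b
  change ι (φ b) * e = e at h
  rw [← sub_eq_zero.mp he, mul_one] at h
  exact hι (h.trans (map_one ι).symm)

/-- A finite group of units of `ℤQ` whose nontrivial elements have vanishing identity coefficient
has order dividing that of `Q`. -/
theorem MonoidAlgebra.natCard_dvd_natCard {Q B : Type*} [Group Q] [Finite Q] [Group B] [Finite B]
    (φ : B →* MonoidAlgebra ℤ Q) (hφ : ∀ b, b ≠ 1 → (φ b).coeff 1 = 0) :
    Nat.card B ∣ Nat.card Q := by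
  classical
  have := Fintype.ofFinite B
  let ι := MonoidAlgebra.mapRingHom Q (Int.castRingHom ℂ)
  have : FiniteDimensional ℂ (MonoidAlgebra ℂ Q) := Module.Finite.of_basis (MonoidAlgebra.basis Q ℂ)
  let e := groupAverage ℂ (ι.toMonoidHom.comp φ)
  have hcard : (Nat.card B : ℂ) ≠ 0 := Nat.cast_ne_zero.mpr Nat.card_pos.ne'
  have hcoeff : e.coeff 1 = (Nat.card B : ℂ)⁻¹ := by
    rw [MonoidAlgebra.coeff_groupAverage, Finset.sum_eq_single 1]
    · simp [ι]
    · intro b _ hb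
      simp [ι, hφ b hb]
    · simp
  have hidem : IsIdempotentElem (LinearMap.mulLeft ℂ e) := by
    rw [IsIdempotentElem, Module.End.mul_eq_comp, ← LinearMap.mulLeft_mul,
      (isIdempotentElem_groupAverage _).eq]
  -- The trace of an idempotent operator is its rank, a natural number.
  have htr := (LinearMap.IsIdempotentElem.isProj_range _ hidem).trace
  rw [MonoidAlgebra.trace_mulLeft, hcoeff, ← div_eq_mul_inv, div_eq_iff hcard] at htr
  exact ⟨_, by rw [mul_comm]; exact_mod_cast htr⟩

/-! ### The main theorem -/

theorem augmentation_mapDomainRingHom {G Q : Type*} [Group G] [Group Q] (f : G →* Q)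
    (a : MonoidAlgebra ℤ G) :
    augmentation Q (MonoidAlgebra.mapDomainRingHom ℤ f a) = augmentation G a := by
  induction a using MonoidAlgebra.induction_linear with
  | zero => simp
  | add a b ha hb => rw [map_add, map_add, map_add, ha, hb]
  | single g c => simp [augmentation]

theorem mainTheorem8 {G : Type*} [Group G] (H : Subgroup G) [H.Normal] [H.FiniteIndex]
    (hnoeth : IsLocallyNoetherianGroup H) (htf : IsTorsionFreeGroup H)
    (A : Subgroup (MonoidAlgebra ℤ G)ˣ) (hA : A ≤ unitsAugOne G) (hfin : Finite A) :
    Nat.card A ∣ H.index ∧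
      Function.Injective (fun a : A =>
        MonoidAlgebra.mapDomainRingHom ℤ (QuotientGroup.mk' H)
          ((a : (MonoidAlgebra ℤ G)ˣ) : MonoidAlgebra ℤ G)) := by

  let π := MonoidAlgebra.mapDomainRingHom ℤ (QuotientGroup.mk' H)
  let φ : A →* MonoidAlgebra ℤ G := (Units.coeHom _).comp A.subtype
  let ψ : A →* (MonoidAlgebra ℤ (G ⧸ H))ˣ := (Units.map π.toMonoidHom).comp A.subtype
  have htors : ∀ a : A, φ a ^ Nat.card A = 1 := fun a => by
    rw [← map_pow, pow_card_eq_one', map_one]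
  have hcoeff : ∀ a : A, (π (φ a)).coeff 1 = (φ a).coeff 1 := fun a =>
    coeff_one_mapDomain_mk_of_pow_eq_one H hnoeth htf Nat.card_pos.ne' (htors a)
  have hψ : Function.Injective ψ := by
    rw [injective_iff_map_eq_one]
    intro a ha
    have hker : ∀ b : ψ.ker, ((φ.comp ψ.ker.subtype) b).coeff 1 = 1 := by
      intro b
      have hb : π (φ b) = 1 := congrArg Units.val b.2
      have h := hcoeff b
      rw [hb, MonoidAlgebra.coeff_one_one] at h
      exact h.symm
    have h := MonoidAlgebra.eq_one_of_forall_coeff_one_eq_one _ hker ⟨a, ha⟩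
    exact Subtype.ext (Units.ext h)
  refine ⟨?_, fun a b hab => hψ (Units.ext hab)⟩
  refine MonoidAlgebra.natCard_dvd_natCard ((Units.coeHom _).comp ψ) fun a ha => ?_
  have hpow : π (φ a) ^ Nat.card A = 1 := by rw [← map_pow, htors, map_one]
  rcases MonoidAlgebra.coeff_one_eq_zero_of_pow_eq_one Nat.card_pos.ne' hpow with h | h | h
  · exact h
  · exact absurd (hψ ((Units.ext h).trans (map_one ψ).symm)) ha
  · have haug := augmentation_mapDomainRingHom (QuotientGroup.mk' H) (φ a)
    change augmentation _ (π (φ a)) = _ at haug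
    have ha1 : augmentation G (φ a) = 1 := (mem_unitsAugOne _).mp (hA a.2)
    rw [h, map_neg, map_one, ha1] at haug
    norm_num at haug
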